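/- Let $\mathbb{H}^2$ be the hyperbolic plane with distance $d$, exponential maps $\exp_p:T_p\mathbb{H}^2\to\mathbb{H}^2$ and tangent bundle $T\mathbb{H}^2$. A *convex field* is a closed subset $X\subset T\mathbb{H}^2$ whose fibers $X(p):=X\cap T_p\mathbb{H}^2$ are convex (possibly empty); it is *defined over* $A\subset\mathbb{H}^2$ if $X(p)\neq\emptyset$ for all $p\in A$, and its *domain* is $\operatorname{dom}X:=\{p: X(p)\ne\emptyset\}$. It is *compact* if it is a compact subset of $T\mathbb{H}^2$ (if $\operatorname{dom}X$ is contained in a compact set, this means that the norms of the vectors of $X$ are bounded). For $k\in\mathbb{R}$, a convex field $X$ is *$k$-lipschitz* if for all distinct $p,q\in\mathbb{H}^2$ and all $x\in X(p)$, $y\in X(q)$, $$\frac{\mathrm d}{\mathrm dt}\Big|_{t=0} d\big(\exp_p(tx),\exp_q(ty)\big)\le k\,d(p,q).$$ A convex field $Y$ is an *extension* of $X$ if $X\subset Y$ and $Y(p)=X(p)$ for every point $p$ of every open set $U\subset\mathbb{H}^2$ over which $X$ is defined. **Theorem 4.1.** Let $\mathscr C\subset\mathbb{H}^2$ be a compact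 set and let $X$ be a compact convex field defined over $\mathscr C$. Suppose that $X$ is $k$-lipschitz with $k\ge 0$. Then $X$ has a $k$-lipschitz compact extension $Y$ (a convex field) defined over the convex hull $\operatorname{Conv}(\mathscr C)$ of $\mathscr C$ in $\mathbb{H}^2$; moreover $Y$ can be chosen with $\operatorname{dom}Y=\operatorname{dom}X\cup\operatorname{Conv}(\mathscr C)$. (In particular, if $\operatorname{dom}X=\mathscr C$, then $\operatorname{dom}Y=\operatorname{Conv}(\mathscr C)$.) -/

import Mathlib

open scoped UpperHalfPlane

noncomputable section

namespace HypConvexField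

/-! The hyperbolic plane is Mathlib's upper half-plane `ℍ` with its hyperbolic metric
(curvature `-1`). Since `ℍ` is an open subset of `ℂ`, its tangent bundle is `ℍ × ℂ` with the
product topology: the pair `(p, v)` is the vector `v` based at `p`, i.e. the velocity at time `0`
of a curve that leaves `p` with complex derivative `v`. The hyperbolic norm of `(p, v)` is
`‖v‖ / Im p`. -/

/-- The tangent bundle of the hyperbolic plane. -/
abbrev TangentH : Type := ℍ × ℂ

/-- The norm of a tangent vector for the hyperbolic Riemannian metric `|dz| / Im z`. -/
def hypNorm (x : TangentH) : ℝ := ‖x.2‖ / x.1.im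

/-- The denominator in the formula for the exponential map. -/
def expDenom (x : TangentH) : ℝ :=
  Real.cosh (hypNorm x) - Real.sinh (hypNorm x) * (x.2.im / ‖x.2‖)

theorem hypNorm_nonneg (x : TangentH) : 0 ≤ hypNorm x :=
  div_nonneg (norm_nonneg _) x.1.im_pos.le

theorem expDenom_pos (x : TangentH) : 0 < expDenom x := by
  have h1 : x.2.im / ‖x.2‖ ≤ 1 :=
    div_le_one_of_le₀ ((le_abs_self _).trans (Complex.abs_im_le_norm _)) (norm_nonneg _)
  have h2 : 0 ≤ Real.sinh (hypNorm x) := Real.sinh_nonneg_iff.2 (hypNorm_nonneg x)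
  have h3 := mul_le_mul_of_nonneg_left h1 h2
  have h4 := Real.sinh_lt_cosh (hypNorm x)
  unfold expDenom
  linarith

/-- The Riemannian exponential map `(p, v) ↦ exp_p v` of the hyperbolic plane, in closed form:
with `r = ‖v‖ / Im p` and `v / ‖v‖ = cos θ + i sin θ`, it is
`Re p + Im p * (sinh r * cos θ + i) / (cosh r - sinh r * sin θ)`; for `v = 0` it is `p`.
The lemmas `dist_hypExp_smul` and `hasDerivAt_hypExp_smul` below show that `t ↦ exp_p (t v)` is the
constant-speed geodesic through `p` with initial velocity `v`. -/
def hypExp (x : TangentH) : ℍ :=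
  ⟨⟨x.1.re + x.1.im * (Real.sinh (hypNorm x) * (x.2.re / ‖x.2‖)) / expDenom x,
    x.1.im / expDenom x⟩, div_pos x.1.im_pos (expDenom_pos x)⟩

theorem hypExp_re (x : TangentH) : (hypExp x).re =
    x.1.re + x.1.im * (Real.sinh (hypNorm x) * (x.2.re / ‖x.2‖)) / expDenom x := rfl

theorem hypExp_im (x : TangentH) : (hypExp x).im = x.1.im / expDenom x := rfl

/-- The curve `t ↦ exp_p (t v)` written without absolute values. -/
theorem hypExp_smul_aux (p : ℍ) {v : ℂ} (hv : v ≠ 0) (t : ℝ) :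
    let r := hypNorm (p, v)
    let D := Real.cosh (t * r) - Real.sinh (t * r) * (v.im / ‖v‖)
    0 < D ∧ (hypExp (p, (t : ℂ) * v)).re
        = p.re + p.im * (Real.sinh (t * r) * (v.re / ‖v‖)) / D ∧
      (hypExp (p, (t : ℂ) * v)).im = p.im / D := by
  intro r D
  have hv' : ‖v‖ ≠ 0 := norm_ne_zero_iff.2 hv
  have hr : hypNorm (p, (t : ℂ) * v) = |t| * r := by
    simp [r, hypNorm, mul_div_assoc]
  have key : ∀ c : ℝ, Real.sinh (|t| * r) * (t * c / (|t| * ‖v‖))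
      = Real.sinh (t * r) * (c / ‖v‖) := by
    intro c
    rcases lt_trichotomy t 0 with h | h | h
    · rw [abs_of_neg h, neg_mul, Real.sinh_neg]
      have := h.ne
      field_simp
    · simp [h]
    · rw [abs_of_pos h]
      have := h.ne'
      field_simp
  have hc : Real.cosh (|t| * r) = Real.cosh (t * r) := by
    rcases abs_choice t with h | h <;> rw [h]
    rw [neg_mul, Real.cosh_neg]
  have hD : expDenom (p, (t : ℂ) * v) = D := by
    simp only [expDenom, hr, D, hc]
    rw [← key]
    simp
  refine ⟨hD ▸ expDenom_pos _, ?_, ?_⟩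
  · rw [← hD, ← key, ← hr]
    simp [hypExp_re]
  · rw [← hD]
    simp [hypExp_im]

/-- `t ↦ exp_p (t v)` is a geodesic line of constant speed `hypNorm (p, v)`. -/
theorem dist_hypExp_smul (p : ℍ) (v : ℂ) (s t : ℝ) :
    dist (hypExp (p, (s : ℂ) * v)) (hypExp (p, (t : ℂ) * v)) = |s - t| * hypNorm (p, v) := by
  by_cases hv : v = 0
  · subst hv
    simp [hypNorm]
  have hv' : ‖v‖ ≠ 0 := norm_ne_zero_iff.2 hv
  obtain ⟨hs, hs1, hs2⟩ := hypExp_smul_aux p hv s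
  obtain ⟨ht, ht1, ht2⟩ := hypExp_smul_aux p hv t
  have hab : (v.re / ‖v‖) ^ 2 + (v.im / ‖v‖) ^ 2 = 1 := by
    have := Complex.sq_norm v
    rw [Complex.normSq_apply] at this
    field_simp
    linarith
  have h0 : 0 ≤ |s - t| * hypNorm (p, v) := mul_nonneg (abs_nonneg _) (hypNorm_nonneg _)
  refine Real.cosh_strictMonoOn.injOn dist_nonneg h0 ?_
  have hc : Real.cosh (|s - t| * hypNorm (p, v))
      = Real.cosh (s * hypNorm (p, v) - t * hypNorm (p, v)) := by
    rw [← sub_mul]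
    rcases abs_choice (s - t) with h | h <;> rw [h]
    rw [neg_mul, Real.cosh_neg]
  rw [UpperHalfPlane.cosh_dist', hs1, hs2, ht1, ht2, hc, Real.cosh_sub]
  have hp := p.im_pos
  generalize v.re / ‖v‖ = a at *
  generalize v.im / ‖v‖ = b at *
  have es := Real.cosh_sq (s * hypNorm (p, v))
  have et := Real.cosh_sq (t * hypNorm (p, v))
  generalize Real.cosh (s * hypNorm (p, v)) = cs at *
  generalize Real.cosh (t * hypNorm (p, v)) = ct at *
  generalize Real.sinh (s * hypNorm (p, v)) = ss at *
  generalize Real.sinh (t * hypNorm (p, v)) = st at *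
  have key : a ^ 2 * (ss * (ct - st * b) - st * (cs - ss * b)) ^ 2 + (ct - st * b) ^ 2
      + (cs - ss * b) ^ 2 = 2 * (cs - ss * b) * (ct - st * b) * (cs * ct - ss * st) := by
    grind
  generalize cs - ss * b = Ds at *
  generalize ct - st * b = Dt at *
  rw [div_eq_iff (by positivity)]
  field_simp
  linear_combination p.im ^ 2 * key

/-- The initial velocity of `t ↦ exp_p (t v)` is `v`. -/
theorem hasDerivAt_hypExp_smul (p : ℍ) (v : ℂ) :
    HasDerivAt (fun t : ℝ => (hypExp (p, (t : ℂ) * v) : ℂ)) v 0 := by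
  by_cases hv : v = 0
  · subst hv
    simpa using hasDerivAt_const (0 : ℝ) (hypExp (p, 0) : ℂ)
  have hv' : ‖v‖ ≠ 0 := norm_ne_zero_iff.2 hv
  have hp := p.im_pos
  set r := hypNorm (p, v) with hr
  set a := v.re / ‖v‖ with ha
  set b := v.im / ‖v‖ with hb
  have hra : p.im * (r * a) = v.re := by
    simp only [hr, ha, hypNorm]; field_simp
  have hrb : p.im * (r * b) = v.im := by
    simp only [hr, hb, hypNorm]; field_simp
  have hlin : HasDerivAt (fun t : ℝ => t * r) r 0 := by
    simpa using (hasDerivAt_id (0 : ℝ)).mul_const r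
  have hsinh : HasDerivAt (fun t : ℝ => Real.sinh (t * r)) r 0 := by
    simpa using hlin.sinh
  have hcosh : HasDerivAt (fun t : ℝ => Real.cosh (t * r)) 0 0 := by
    simpa using hlin.cosh
  have hD : HasDerivAt (fun t : ℝ => Real.cosh (t * r) - Real.sinh (t * r) * b) (0 - r * b) 0 :=
    hcosh.sub (hsinh.mul_const b)
  have h1 : HasDerivAt (fun t : ℝ => p.re + p.im * (Real.sinh (t * r) * a) /
      (Real.cosh (t * r) - Real.sinh (t * r) * b)) v.re 0 := by
    refine ((((hsinh.mul_const a).const_mul p.im).div hD (by simp)).const_add p.re).congr_deriv ?_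
    simp [hra]
  have h2 : HasDerivAt (fun t : ℝ => p.im /
      (Real.cosh (t * r) - Real.sinh (t * r) * b)) v.im 0 := by
    refine (((hasDerivAt_const (0 : ℝ) p.im).div hD (by simp))).congr_deriv ?_
    simp [hrb]
  have h3 := h1.ofReal_comp.add (h2.ofReal_comp.mul_const Complex.I)
  rw [Complex.re_add_im] at h3
  refine h3.congr_of_eventuallyEq (Filter.Eventually.of_forall fun t => ?_)
  obtain ⟨-, e1, e2⟩ := hypExp_smul_aux p hv t
  rw [Pi.add_apply, ← e1, ← e2]
  simpa using (Complex.re_add_im (hypExp (p, (t : ℂ) * v) : ℂ)).symm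

/-- The rate of change `d'(x, y)` of the distance between the base points of two tangent
vectors: the derivative at `t = 0` of `d(exp_p (t x), exp_q (t y))`. -/
def dPrime (x y : TangentH) : ℝ :=
  deriv (fun t : ℝ => dist (hypExp (x.1, (t : ℂ) * x.2)) (hypExp (y.1, (t : ℂ) * y.2))) 0

/-- Between distinct base points the derivative that defines `d'` exists. -/
theorem hasDerivAt_dPrime (x y : TangentH) (h : x.1 ≠ y.1) :
    HasDerivAt (fun t : ℝ => dist (hypExp (x.1, (t : ℂ) * x.2)) (hypExp (y.1, (t : ℂ) * y.2)))
      (dPrime x y) 0 := by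
  refine DifferentiableAt.hasDerivAt ?_
  have hz : ∀ p : ℍ, hypExp (p, 0) = p := fun p => by
    apply UpperHalfPlane.ext_re_im <;> simp [hypExp_re, hypExp_im, expDenom, hypNorm]
  have hx := (hasDerivAt_hypExp_smul x.1 x.2).differentiableAt
  have hy := (hasDerivAt_hypExp_smul y.1 y.2).differentiableAt
  have hxi := Complex.imCLM.differentiableAt.comp (0 : ℝ) hx
  have hyi := Complex.imCLM.differentiableAt.comp (0 : ℝ) hy
  have hne : (hypExp (x.1, ((0 : ℝ) : ℂ) * x.2) : ℂ) - hypExp (y.1, ((0 : ℝ) : ℂ) * y.2) ≠ 0 := by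
    rw [sub_ne_zero, Complex.ofReal_zero, zero_mul, zero_mul, hz, hz]
    exact fun e => h (UpperHalfPlane.ext e)
  have hn := (hx.sub hy).norm ℝ hne
  simp only [UpperHalfPlane.dist_eq, Complex.dist_eq]
  have hpos : ∀ t : ℝ, 0 < (hypExp (x.1, (t : ℂ) * x.2)).im * (hypExp (y.1, (t : ℂ) * y.2)).im :=
    fun t => mul_pos (UpperHalfPlane.im_pos _) (UpperHalfPlane.im_pos _)
  refine (DifferentiableAt.arsinh ?_).const_mul 2
  refine hn.div (((hxi.mul hyi).sqrt (hpos 0).ne').const_mul 2) ?_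
  exact mul_ne_zero two_ne_zero (Real.sqrt_pos.2 (hpos 0)).ne'

/-- The fiber `X(p)`, as a subset of the tangent plane at `p`. -/
def fiber (X : Set TangentH) (p : ℍ) : Set ℂ := {v | (p, v) ∈ X}

/-- The set of points over which `X` is defined, i.e. has a nonempty fiber. -/
def domain (X : Set TangentH) : Set ℍ := {p | (fiber X p).Nonempty}

/-- A convex field: a closed subset of the tangent bundle with convex (possibly empty) fibers. -/
def IsConvexField (X : Set TangentH) : Prop :=
  IsClosed X ∧ ∀ p : ℍ, Convex ℝ (fiber X p)

/-- `X` is `k`-lipschitz (infinitesimally). -/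
def IsLip (k : ℝ) (X : Set TangentH) : Prop :=
  ∀ x ∈ X, ∀ y ∈ X, x.1 ≠ y.1 → dPrime x y ≤ k * dist x.1 y.1

/-- A convex field over a compact set is compact if and only if it is bounded. -/
theorem isCompact_iff_bounded {X : Set TangentH} (hX : IsConvexField X) {C : Set ℍ}
    (hC : IsCompact C) (hXC : domain X ⊆ C) :
    IsCompact X ↔ ∃ R : ℝ, ∀ x ∈ X, hypNorm x ≤ R := by
  have hcont : Continuous hypNorm :=
    continuous_snd.norm.div (UpperHalfPlane.continuous_im.comp continuous_fst)
      fun x => x.1.im_ne_zero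
  constructor
  · intro h
    obtain ⟨R, hR⟩ := h.bddAbove_image hcont.continuousOn
    exact ⟨R, fun x hx => hR ⟨x, hx, rfl⟩⟩
  · rintro ⟨R, hR⟩
    obtain ⟨M, hM⟩ := hC.bddAbove_image UpperHalfPlane.continuous_im.continuousOn
    refine (hC.prod (isCompact_closedBall (0 : ℂ) (|R| * M))).of_isClosed_subset hX.1 ?_
    rintro ⟨p, v⟩ hx
    have hp : p ∈ C := hXC ⟨v, hx⟩
    refine ⟨hp, ?_⟩
    have h1 : ‖v‖ ≤ R * p.im := (div_le_iff₀ p.im_pos).1 (hR _ hx)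
    have h2 : p.im ≤ M := hM ⟨p, hp, rfl⟩
    have h3 : R * p.im ≤ |R| * p.im := mul_le_mul_of_nonneg_right (le_abs_self R) p.im_pos.le
    have h4 : |R| * p.im ≤ |R| * M := mul_le_mul_of_nonneg_left h2 (abs_nonneg R)
    simpa using h1.trans (h3.trans h4)

/-- `Y` is an extension of `X`: it contains `X`, and has the same fibers as `X` above every open
set over which `X` is defined. -/
def IsExtension (X Y : Set TangentH) : Prop :=
  X ⊆ Y ∧ ∀ U : Set ℍ, IsOpen U → U ⊆ domain X → ∀ p ∈ U, fiber Y p = fiber X p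

/-- The geodesic segment between two points of the hyperbolic plane. -/
def geodSegment (p q : ℍ) : Set ℍ := {r | dist p r + dist r q = dist p q}

/-- Geodesic convexity in the hyperbolic plane. -/
def GeodConvex (A : Set ℍ) : Prop := ∀ p ∈ A, ∀ q ∈ A, geodSegment p q ⊆ A

/-- The convex hull in the hyperbolic plane: the smallest geodesically convex superset. -/
def hypConvexHull (A : Set ℍ) : Set ℍ := ⋂₀ {B | A ⊆ B ∧ GeodConvex B}

end HypConvexField

end

open scoped UpperHalfPlane

namespace HypConvexField

/-! ### A convexity inequality for hyperbolic triangles -/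

/-! In the hyperboloid model `cosh (dist p q)` is the pairing of the lifts of `p` and `q`.
Differentiating it turns the lipschitz condition into `rate x y ≤ k * (d * sinh d)`, where `d` is
the distance of the base points (`isLip_iff`). The left side is affine in each vector, so the
condition survives closures and fiberwise convex hulls.

To extend by one point `p`, a vector `v` has to satisfy one affine inequality per vector of the
field. By duality a finite subsystem can fail only through weights for which `p` is, up to scale,
the barycenter of the lifted base points. In that case the pairwise lipschitz inequalities, weighted
by `μ i * μ j` and compared with the triangle inequality `mul_sinh_le_of_triangle`, give the
inequality that rules out failure (`sum_mul_lform_tlift_le`); here `k ≥ 0` is needed.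

To pass to infinitely many constraints, `v` must stay bounded. For this a strongly inward field is
added on an annulus around a ball containing `domain X`. It is compatible with `X`
(`exists_isLip_union_inwardField`) and bounds every compatible vector over the ball
(`exists_inner_le`).

Zorn's lemma then gives a maximal field over the ball. Maximality makes it closed, convex and
defined over the whole ball, and the barrier makes it compact. Its restriction to `domain X ∪
hypConvexHull C` is the extension. -/

theorem mul_sinh_le_mul_sinh {s t : ℝ} (hs : 0 ≤ s) (hst : s ≤ t) :
    t * Real.sinh s ≤ s * Real.sinh t := by
  rcases hs.eq_or_lt with rfl | hs'
  · simp
  have ht : 0 < t := hs'.trans_le hst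
  have hconv : ConvexOn ℝ (Set.Ici (0 : ℝ)) Real.sinh := by
    refine MonotoneOn.convexOn_of_deriv (convex_Ici 0) Real.continuous_sinh.continuousOn
      Real.differentiable_sinh.differentiableOn ?_
    rw [interior_Ici, Real.deriv_sinh]
    intro x hx y hy hxy
    exact Real.cosh_le_cosh.2 (by rwa [abs_of_pos hx, abs_of_pos hy])
  have h := hconv.2 (Set.mem_Ici.2 ht.le) (Set.mem_Ici.2 le_rfl)
    (show 0 ≤ s / t by positivity)
    (show 0 ≤ 1 - s / t from sub_nonneg.2 (div_le_one_of_le₀ hst ht.le)) (by ring)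
  simp only [smul_eq_mul, mul_zero, add_zero, Real.sinh_zero] at h
  rw [div_mul_cancel₀ _ ht.ne', div_mul_eq_mul_div, le_div_iff₀ ht] at h
  linarith

/-- After cross-multiplication this is the monotonicity of `sinh t / t` between `z - x` and `z + x`.
-/
theorem mul_coth_le_mul_coth {x z : ℝ} (hx : 0 < x) (hxz : x ≤ z) :
    x * Real.cosh x / Real.sinh x ≤ z * Real.cosh z / Real.sinh z := by
  have hz := hx.trans_le hxz
  rw [div_le_div_iff₀ (Real.sinh_pos_iff.2 hx) (Real.sinh_pos_iff.2 hz)]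
  have h := mul_sinh_le_mul_sinh (s := z - x) (t := z + x) (by linarith) (by linarith)
  rw [Real.sinh_add, Real.sinh_sub] at h
  linarith

/-- With `y = cosh c` the function is `c * sinh c`, and its derivative in `y` is `1 + c * coth c`,
which is increasing. -/
theorem convexOn_arcosh_mul_sqrt :
    ConvexOn ℝ (Set.Ici (1 : ℝ)) fun y => Real.arcosh y * √(y ^ 2 - 1) := by
  have hderiv : ∀ y ∈ Set.Ioi (1 : ℝ), HasDerivAt (fun y => Real.arcosh y * √(y ^ 2 - 1))
      (1 + Real.arcosh y * y / √(y ^ 2 - 1)) y := by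
    intro y hy
    have hy' : (1 : ℝ) < y := hy
    have hpos : 0 < y ^ 2 - 1 := by nlinarith
    have h1 := Real.hasDerivAt_arcosh hy
    have h2 : HasDerivAt (fun y : ℝ => y ^ 2 - 1) (2 * y) y := by
      simpa using (hasDerivAt_pow 2 y).sub_const 1
    have h3 := h1.mul (h2.sqrt hpos.ne')
    refine h3.congr_deriv ?_
    have := (Real.sqrt_pos.2 hpos).ne'
    field_simp
  refine MonotoneOn.convexOn_of_deriv (convex_Ici 1) ?_ ?_ ?_
  · exact Real.continuousOn_arcosh.mul (by fun_prop)
  · rw [interior_Ici]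
    exact fun y hy => (hderiv y hy).differentiableAt.differentiableWithinAt
  · rw [interior_Ici]
    intro x hx y hy hxy
    rw [(hderiv x hx).deriv, (hderiv y hy).deriv]
    have key := mul_coth_le_mul_coth (Real.arcosh_pos hx)
      ((Real.arcosh_le_arcosh (zero_lt_one.trans hx) (zero_lt_one.trans hy)).2 hxy)
    rw [Real.cosh_arcosh (le_of_lt hx), Real.cosh_arcosh (le_of_lt hy),
      Real.sinh_arcosh (le_of_lt hx), Real.sinh_arcosh (le_of_lt hy)] at key
    linarith

theorem arcosh_mul_sqrt_cosh (c : ℝ) :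
    Real.arcosh (Real.cosh c) * √(Real.cosh c ^ 2 - 1) = c * Real.sinh c := by
  rw [← Real.cosh_abs, Real.arcosh_cosh (abs_nonneg c), ← Real.sinh_sq, Real.sqrt_sq_eq_abs,
    Real.abs_sinh, abs_abs]
  rcases abs_choice c with h | h <;> rw [h]
  rw [Real.sinh_neg]; ring

/-- In a hyperbolic triangle with sides `a, b, c` and angles `α, β` adjacent to `c`, one has
`c ≤ a cos α + b cos β`; both sides are multiplied by `sinh c`. -/
theorem mul_sinh_le_of_triangle {a b c : ℝ} (ha : 0 < a) (hb : 0 < b) (hab : |a - b| ≤ c)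
    (hc : c ≤ a + b) :
    c * Real.sinh c ≤ a / Real.sinh a * (Real.cosh a * Real.cosh c - Real.cosh b) +
      b / Real.sinh b * (Real.cosh b * Real.cosh c - Real.cosh a) := by
  have hc0 : 0 ≤ c := (abs_nonneg _).trans hab
  have h1 : Real.cosh (a - b) ≤ Real.cosh c := by
    rw [Real.cosh_le_cosh, abs_of_nonneg hc0]; exact hab
  have h2 : Real.cosh c ≤ Real.cosh (a + b) := by
    rw [Real.cosh_le_cosh, abs_of_nonneg hc0]; exact hc.trans (le_abs_self _)
  -- For fixed `a` and `b` the right side is affine in `cosh c` and the left side is convex in it.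
  -- The two agree for the degenerate triangles `c = |a - b|` and `c = a + b`, so the inequality
  -- holds in between.
  have hmem : Real.cosh c ∈ segment ℝ (Real.cosh (a - b)) (Real.cosh (a + b)) := by
    rw [segment_eq_Icc (h1.trans h2)]; exact ⟨h1, h2⟩
  obtain ⟨s, t, hs, ht, hst, e⟩ := hmem
  have h := convexOn_arcosh_mul_sqrt.2 (Set.mem_Ici.2 (Real.one_le_cosh (a - b)))
    (Set.mem_Ici.2 (Real.one_le_cosh (a + b))) hs ht hst
  simp only [e] at h
  simp only [arcosh_mul_sqrt_cosh, smul_eq_mul] at h e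
  refine h.trans (le_of_eq ?_)
  have hsa := (Real.sinh_pos_iff.2 ha).ne'
  have hsb := (Real.sinh_pos_iff.2 hb).ne'
  rw [← e, Real.cosh_add, Real.cosh_sub, Real.sinh_add, Real.sinh_sub]
  have hA := Real.cosh_sq a
  have hB := Real.cosh_sq b
  generalize Real.cosh a = ca at *
  generalize Real.sinh a = sa at *
  generalize Real.cosh b = cb at *
  generalize Real.sinh b = sb at *
  obtain rfl : s = 1 - t := by linarith
  field_simp
  grind

/-! ### Systems of finitely many linear inequalities -/

/-- A finite system `a i v ≤ b i` is solvable if every convex combination of the `a i` that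
vanishes has a positive right-hand side. -/
theorem exists_forall_le_of_stdSimplex {ι E : Type*} [Fintype ι] [NormedAddCommGroup E]
    [InnerProductSpace ℝ E] [FiniteDimensional ℝ E] (a : ι → E) (b : ι → ℝ)
    (h : ∀ μ ∈ stdSimplex ℝ ι, ∑ i, μ i • a i = 0 → 0 < ∑ i, μ i * b i) :
    ∃ v : E, ∀ i, inner ℝ v (a i) ≤ b i := by
  classical
  let L : (ι → ℝ) →ₗ[ℝ] E × ℝ :=
    (∑ i, (LinearMap.proj i : (ι → ℝ) →ₗ[ℝ] ℝ).smulRight ((a i, b i) : E × ℝ))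
  have hL : ∀ μ, L μ = (∑ i, μ i • a i, ∑ i, μ i * b i) := by
    intro μ
    ext <;> simp [L, Prod.fst_sum, Prod.snd_sum]
  have hLc : Continuous L := L.continuous_of_finiteDimensional
  let t : Set (E × ℝ) := {0} ×ˢ Set.Iic 0
  have ht1 : Convex ℝ t := (convex_singleton 0).prod (convex_Iic 0)
  have ht2 : IsClosed t := isClosed_singleton.prod isClosed_Iic
  -- The hypothesis says that the convex hull of the points `(a i, b i)` misses the closed ray `{0}
  -- × (-∞, 0]`. The separating functional has the form `(z, σ)`; the ray forces `σ ≤ 0`.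
  obtain ⟨f, u, w, h1, h2, h3⟩ := geometric_hahn_banach_compact_closed
    ((convex_stdSimplex ℝ ι).linear_image L) ((isCompact_stdSimplex ℝ ι).image hLc) ht1 ht2 (by
      rw [Set.disjoint_left]
      rintro _ ⟨μ, hμ, rfl⟩ hx
      rw [hL] at hx
      exact absurd (h μ hμ hx.1) (not_lt.2 hx.2))
  have hw : w < 0 := by simpa using h3 0 ⟨rfl, le_refl (0 : ℝ)⟩
  set σ := f (0, 1) with hσ
  let g : StrongDual ℝ E := f.comp (ContinuousLinearMap.inl ℝ E ℝ)
  set z := (InnerProductSpace.toDual ℝ E).symm g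
  have hf : ∀ x : E, ∀ r : ℝ, f (x, r) = inner ℝ z x + r * σ := by
    intro x r
    rw [InnerProductSpace.toDual_symm_apply]
    have : (x, r) = (x, (0 : ℝ)) + r • ((0 : E), (1 : ℝ)) := by simp
    rw [this, map_add, map_smul]
    rfl
  have hneg : ∀ i, inner ℝ z (a i) + b i * σ < 0 := by
    intro i
    have := h1 (L (Pi.single i 1)) ⟨_, single_mem_stdSimplex ℝ i, rfl⟩
    have e : L (Pi.single i 1) = (a i, b i) := by
      rw [hL]; simp [Pi.single_apply]
    rw [e, hf] at this
    linarith
  have hσ0 : σ ≤ 0 := by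
    by_contra hpos
    push Not at hpos
    have := h3 (0, w / σ) ⟨rfl, (div_nonpos_of_nonpos_of_nonneg hw.le hpos.le)⟩
    rw [hf, inner_zero_right, div_mul_cancel₀ _ hpos.ne'] at this
    linarith
  rcases hσ0.lt_or_eq with hlt | heq
  · refine ⟨(-σ)⁻¹ • z, fun i => ?_⟩
    rw [real_inner_smul_left, inv_mul_le_iff₀ (by linarith)]
    linarith [hneg i]
  -- If `σ = 0`, then `z` pairs negatively with every `a i`, so a large multiple of `z` meets all
  -- the bounds.
  · have hev : ∀ i, ∀ᶠ r : ℝ in Filter.atTop, inner ℝ (r • z) (a i) ≤ b i := by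
      intro i
      have hi : inner ℝ z (a i) < 0 := by simpa [heq] using hneg i
      filter_upwards [Filter.eventually_ge_atTop (b i / inner ℝ z (a i))] with r hr
      rw [real_inner_smul_left]
      exact (div_le_iff_of_neg hi).1 hr
    obtain ⟨r, hr⟩ := (Filter.eventually_all.2 hev).exists
    exact ⟨r • z, hr⟩

/-! ### The hyperboloid model -/

/-- A Lorentzian form on `ℝ³`, normalized to be positive on timelike vectors. -/
noncomputable def lform : (ℝ × ℝ × ℝ) →ₗ[ℝ] (ℝ × ℝ × ℝ) →ₗ[ℝ] ℝ :=
  LinearMap.mk₂ ℝ (fun P Q => (P.1 * Q.2.2 + P.2.2 * Q.1) / 2 - P.2.1 * Q.2.1)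
    (fun P P' Q => by simp only [Prod.fst_add, Prod.snd_add]; ring)
    (fun c P Q => by simp only [Prod.smul_fst, Prod.smul_snd, smul_eq_mul]; ring)
    (fun P Q Q' => by simp only [Prod.fst_add, Prod.snd_add]; ring)
    (fun c P Q => by simp only [Prod.smul_fst, Prod.smul_snd, smul_eq_mul]; ring)

theorem lform_apply (P Q : ℝ × ℝ × ℝ) :
    lform P Q = (P.1 * Q.2.2 + P.2.2 * Q.1) / 2 - P.2.1 * Q.2.1 := rfl

theorem lform_comm (P Q : ℝ × ℝ × ℝ) : lform P Q = lform Q P := by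
  simp only [lform_apply]; ring

/-- The point of the hyperboloid that corresponds to a point of the upper half-plane. -/
noncomputable def lift (z : ℍ) : ℝ × ℝ × ℝ := (1 / z.im, z.re / z.im, (z.re ^ 2 + z.im ^ 2) / z.im)

/-- The differential of `lift`. -/
noncomputable def tlift (x : TangentH) : ℝ × ℝ × ℝ :=
  (-x.2.im / x.1.im ^ 2, x.2.re / x.1.im - x.1.re * x.2.im / x.1.im ^ 2,
    2 * (x.1.re * x.2.re + x.1.im * x.2.im) / x.1.im -
      (x.1.re ^ 2 + x.1.im ^ 2) * x.2.im / x.1.im ^ 2)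

/-- Reading a triple as the entries of a symmetric 2×2 matrix, `lform` is the polarized determinant
and the lifts have determinant one. -/
theorem lform_lift (z w : ℍ) : lform (lift z) (lift w) = Real.cosh (dist z w) := by
  rw [UpperHalfPlane.cosh_dist']
  have hz := z.im_pos.ne'
  have hw := w.im_pos.ne'
  simp only [lform_apply, lift]
  field_simp
  ring

theorem lform_lift_self (z : ℍ) : lform (lift z) (lift z) = 1 := by
  rw [lform_lift, dist_self, Real.cosh_zero]

theorem one_le_lform_lift (z w : ℍ) : 1 ≤ lform (lift z) (lift w) := by
  rw [lform_lift]; exact Real.one_le_cosh _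

theorem lform_tlift_lift_self (p : ℍ) (v : ℂ) : lform (tlift (p, v)) (lift p) = 0 := by
  have hp := p.im_pos.ne'
  simp only [lform_apply, lift, tlift]
  field_simp
  ring

theorem lform_tlift_tlift (p : ℍ) (v w : ℂ) :
    lform (tlift (p, v)) (tlift (p, w)) = -inner ℝ v w / p.im ^ 2 := by
  have hp := p.im_pos.ne'
  simp only [lform_apply, tlift, Complex.inner, Complex.mul_re, Complex.conj_re, Complex.conj_im]
  field_simp
  ring

theorem tlift_add (p : ℍ) (v w : ℂ) : tlift (p, v + w) = tlift (p, v) + tlift (p, w) := by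
  simp only [tlift, Complex.add_re, Complex.add_im]
  ext <;> simp only [Prod.fst_add, Prod.snd_add] <;> ring

theorem tlift_smul (p : ℍ) (c : ℝ) (v : ℂ) : tlift (p, c • v) = c • tlift (p, v) := by
  simp only [tlift, Complex.smul_re, Complex.smul_im]
  ext <;> simp only [Prod.smul_fst, Prod.smul_snd, smul_eq_mul] <;> ring

/-- The orthogonal complement of a point of the hyperboloid consists of tangent vectors. -/
theorem exists_tlift_eq (p : ℍ) (N : ℝ × ℝ × ℝ) (h : lform N (lift p) = 0) :
    ∃ v, tlift (p, v) = N := by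
  have hp := p.im_pos.ne'
  refine ⟨⟨p.im * N.2.1 - p.re * p.im * N.1, -p.im ^ 2 * N.1⟩, ?_⟩
  have e : N.2.2 = 2 * p.re * N.2.1 - (p.re ^ 2 + p.im ^ 2) * N.1 := by
    simp only [lform_apply, lift] at h
    field_simp at h
    linarith
  ext
  · simp only [tlift]; field_simp
  · simp only [tlift]; field_simp; ring
  · simp only [tlift, e]; field_simp; ring

/-- The form is negative definite on the orthogonal complement of `lift p`. Vector identities can
therefore be proved by testing pairings. -/
theorem eq_zero_of_lform_nonneg (p : ℍ) {N : ℝ × ℝ × ℝ} (h : lform N (lift p) = 0)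
    (h' : 0 ≤ lform N N) : N = 0 := by
  obtain ⟨v, rfl⟩ := exists_tlift_eq p N h
  rw [lform_tlift_tlift, real_inner_self_eq_norm_sq] at h'
  have hp : 0 < p.im ^ 2 := by have := p.im_pos; positivity
  have hv : v = 0 := by
    rw [neg_div, neg_nonneg] at h'
    have := (div_le_iff₀ hp).1 h'
    rw [← norm_eq_zero]
    nlinarith [norm_nonneg v]
  subst hv
  simp [tlift]

theorem lift_hypExp (p : ℍ) {v : ℂ} (hv : v ≠ 0) (t : ℝ) :
    lift (hypExp (p, (t : ℂ) * v)) = Real.cosh (t * hypNorm (p, v)) • lift p +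
      (Real.sinh (t * hypNorm (p, v)) / hypNorm (p, v)) • tlift (p, v) := by
  obtain ⟨hD, h1, h2⟩ := hypExp_smul_aux p hv t
  have hn : ‖v‖ ≠ 0 := norm_ne_zero_iff.2 hv
  have hp := p.im_pos.ne'
  have hab : v.re ^ 2 + v.im ^ 2 = ‖v‖ ^ 2 := by
    rw [Complex.sq_norm, Complex.normSq_apply]; ring
  have hsc := Real.cosh_sq (t * hypNorm (p, v))
  have hr : Real.sinh (t * hypNorm (p, v)) / hypNorm (p, v)
      = Real.sinh (t * hypNorm (p, v)) * p.im / ‖v‖ := by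
    simp only [hypNorm]; field_simp
  rw [hr]
  simp only [lift, tlift, h1, h2]
  generalize Real.cosh (t * hypNorm (p, v)) = c at *
  generalize Real.sinh (t * hypNorm (p, v)) = s at *
  have hD' := hD.ne'
  generalize hn' : ‖v‖ = n at *
  have hDn : c * n - s * v.im ≠ 0 := by
    intro h0
    apply hD'
    field_simp
    linarith
  have hDn' : n * c - s * v.im ≠ 0 := by rwa [mul_comm n c]
  have e : c - s * (v.im / n) = (c * n - s * v.im) / n := by field_simp
  ext
  · simp only [Prod.fst_add, Prod.smul_fst, smul_eq_mul]
    field_simp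
    ring
  · simp only [Prod.fst_add, Prod.smul_fst, Prod.snd_add, Prod.smul_snd, smul_eq_mul]
    rw [e]
    field_simp
    ring
  · simp only [Prod.snd_add, Prod.smul_snd, smul_eq_mul]
    rw [e]
    field_simp
    grind

/-! ### The rate of change of the distance in the hyperboloid model -/

/-- The bilinear expression `sinh (dist x.1 y.1) * dPrime x y`. -/
noncomputable def rate (x y : TangentH) : ℝ := lform (tlift x) (lift y.1) + lform (lift x.1) (tlift y)

theorem rate_comm (x y : TangentH) : rate x y = rate y x := by
  unfold rate
  rw [lform_comm (tlift x), lform_comm (lift x.1), add_comm]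

theorem rate_eq_zero {x y : TangentH} (h : x.1 = y.1) : rate x y = 0 := by
  obtain ⟨p, v⟩ := x
  obtain ⟨q, w⟩ := y
  obtain rfl : p = q := h
  rw [rate, lform_comm (lift _), lform_tlift_lift_self, lform_tlift_lift_self, add_zero]

theorem hypExp_zero (p : ℍ) : hypExp (p, 0) = p := by
  apply UpperHalfPlane.ext_re_im <;> simp [hypExp_re, hypExp_im, expDenom, hypNorm]

/-- Both sides are the derivative of `lform_lift` along the two geodesics. -/
theorem sinh_mul_dPrime (x y : TangentH) (h : x.1 ≠ y.1) :
    Real.sinh (dist x.1 y.1) * dPrime x y = rate x y := by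
  have hre : ∀ z : TangentH, HasDerivAt (fun t : ℝ => (hypExp (z.1, (t : ℂ) * z.2)).re) z.2.re 0 :=
    fun z => Complex.reCLM.hasFDerivAt.comp_hasDerivAt (0 : ℝ) (hasDerivAt_hypExp_smul z.1 z.2)
  have him : ∀ z : TangentH, HasDerivAt (fun t : ℝ => (hypExp (z.1, (t : ℂ) * z.2)).im) z.2.im 0 :=
    fun z => Complex.imCLM.hasFDerivAt.comp_hasDerivAt (0 : ℝ) (hasDerivAt_hypExp_smul z.1 z.2)
  have h0 : ∀ z : TangentH, hypExp (z.1, ((0 : ℝ) : ℂ) * z.2) = z.1 := by simp [hypExp_zero]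
  have e0 : ∀ z : TangentH, HasDerivAt
      (fun t : ℝ => (lift (hypExp (z.1, (t : ℂ) * z.2))).1) (tlift z).1 0 := by
    intro z
    have hp := z.1.im_pos.ne'
    refine ((hasDerivAt_const (0 : ℝ) (1 : ℝ)).div (him z) (by rw [h0]; exact hp)).congr_deriv ?_
    simp only [h0, tlift]
    ring
  have e1 : ∀ z : TangentH, HasDerivAt
      (fun t : ℝ => (lift (hypExp (z.1, (t : ℂ) * z.2))).2.1) (tlift z).2.1 0 := by
    intro z
    have hp := z.1.im_pos.ne'
    refine ((hre z).div (him z) (by rw [h0]; exact hp)).congr_deriv ?_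
    simp only [h0, tlift]
    field_simp
  have e2 : ∀ z : TangentH, HasDerivAt
      (fun t : ℝ => (lift (hypExp (z.1, (t : ℂ) * z.2))).2.2) (tlift z).2.2 0 := by
    intro z
    have hp := z.1.im_pos.ne'
    refine ((((hre z).pow 2).add ((him z).pow 2)).div (him z)
      (by rw [h0]; exact hp)).congr_deriv ?_
    simp only [h0, tlift, Pi.add_apply, Pi.pow_apply]
    field_simp
    ring
  have h1 := (hasDerivAt_dPrime x y h).cosh
  have h2 := ((((e0 x).mul (e2 y)).add ((e2 x).mul (e0 y))).div_const 2).sub ((e1 x).mul (e1 y))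
  have h3 := h1.unique (h2.congr_of_eventuallyEq (Filter.Eventually.of_forall fun t => by
    simp only [← lform_lift]
    rfl))
  simp only [h0] at h3
  rw [h3, rate, lform_apply, lform_apply]
  ring

/-- Multiplying by `sinh` of the distance removes the restriction to distinct base points, where
both sides now vanish. -/
theorem isLip_iff {k : ℝ} {X : Set TangentH} : IsLip k X ↔
    ∀ x ∈ X, ∀ y ∈ X, rate x y ≤ k * (dist x.1 y.1 * Real.sinh (dist x.1 y.1)) := by
  refine forall₂_congr fun x _ => forall₂_congr fun y _ => ?_
  by_cases h : x.1 = y.1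
  · simp [h, rate_eq_zero h]
  · have hs : 0 < Real.sinh (dist x.1 y.1) := Real.sinh_pos_iff.2 (dist_pos.2 h)
    rw [← sinh_mul_dPrime x y h]
    simp only [ne_eq, h, not_false_eq_true, forall_const]
    rw [← mul_le_mul_iff_right₀ hs]
    ring_nf

theorem continuous_lift : Continuous lift := by
  have h1 := UpperHalfPlane.continuous_im
  have h2 := UpperHalfPlane.continuous_re
  unfold lift
  exact (continuous_const.div h1 fun z => z.im_ne_zero).prodMk
    ((h2.div h1 fun z => z.im_ne_zero).prodMk
      (((h2.pow 2).add (h1.pow 2)).div h1 fun z => z.im_ne_zero))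

theorem continuous_tlift : Continuous tlift := by
  have h1 : Continuous fun x : TangentH => x.1.im := UpperHalfPlane.continuous_im.comp continuous_fst
  have h2 : Continuous fun x : TangentH => x.1.re := UpperHalfPlane.continuous_re.comp continuous_fst
  have h3 : Continuous fun x : TangentH => x.2.re := Complex.continuous_re.comp continuous_snd
  have h4 : Continuous fun x : TangentH => x.2.im := Complex.continuous_im.comp continuous_snd
  have h5 : ∀ x : TangentH, x.1.im ≠ 0 := fun x => x.1.im_ne_zero
  have h6 : ∀ x : TangentH, x.1.im ^ 2 ≠ 0 := fun x => pow_ne_zero 2 x.1.im_ne_zero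
  unfold tlift
  fun_prop (disch := assumption)

theorem continuous_lform : Continuous fun x : (ℝ × ℝ × ℝ) × (ℝ × ℝ × ℝ) => lform x.1 x.2 := by
  simp only [lform_apply]
  fun_prop

theorem continuous_rate : Continuous fun z : TangentH × TangentH => rate z.1 z.2 := by
  unfold rate
  exact (continuous_lform.comp ((continuous_tlift.comp continuous_fst).prodMk
      (continuous_lift.comp (continuous_fst.comp continuous_snd)))).add
    (continuous_lform.comp ((continuous_lift.comp (continuous_fst.comp continuous_fst)).prodMk
      (continuous_tlift.comp continuous_snd)))

/-! ### Convex hulls of compact sets -/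

theorem isCompact_convexHull {E : Type*} [NormedAddCommGroup E] [NormedSpace ℝ E]
    [FiniteDimensional ℝ E] {s : Set E} (hs : IsCompact s) : IsCompact (convexHull ℝ s) := by
  rcases s.eq_empty_or_nonempty with rfl | ⟨x₀, hx₀⟩
  · simp
  -- By Carathéodory's theorem this many points suffice; shorter combinations are padded with weight
  -- `0` at `x₀`.
  let n := Module.finrank ℝ E + 1
  let F : (Fin n → ℝ) × (Fin n → E) → E := fun z => ∑ i, z.1 i • z.2 i
  have hF : Continuous F := by fun_prop
  have hK := ((isCompact_stdSimplex ℝ (Fin n)).prod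
    (isCompact_univ_pi fun _ : Fin n => hs)).image hF
  convert hK using 1
  apply Set.Subset.antisymm
  · intro x hx
    obtain ⟨ι, _, z, w, hz, hind, hw, hw1, hwx⟩ := eq_pos_convex_span_of_mem_convexHull hx
    have hcard : Fintype.card ι ≤ Fintype.card (Fin n) := by
      rw [Fintype.card_fin]
      exact hind.card_le_finrank_succ.trans
        (Nat.succ_le_succ (Submodule.finrank_le _))
    obtain ⟨e⟩ := Function.Embedding.nonempty_of_card_le hcard
    have hout : ∀ i ∉ Set.range e, Function.extend e w 0 i = 0 := fun i hi =>
      Function.extend_apply' _ _ _ fun ⟨a, ha⟩ => hi ⟨a, ha⟩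
    refine ⟨(Function.extend e w 0, Function.extend e z fun _ => x₀), ⟨⟨fun i => ?_, ?_⟩, ?_⟩, ?_⟩
    · by_cases hi : i ∈ Set.range e
      · obtain ⟨a, rfl⟩ := hi
        simp only [e.injective.extend_apply]
        exact (hw a).le
      · exact (hout i hi).ge
    · rw [← hw1]
      refine (Fintype.sum_of_injective e e.injective _ _ hout fun a => ?_).symm
      rw [e.injective.extend_apply]
    · intro i _
      by_cases hi : i ∈ Set.range e
      · obtain ⟨a, rfl⟩ := hi
        simp only [e.injective.extend_apply]
        exact hz ⟨a, rfl⟩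
      · simp only
        rw [Function.extend_apply' _ _ _ fun ⟨a, ha⟩ => hi ⟨a, ha⟩]
        exact hx₀
    · rw [← hwx]
      refine (Fintype.sum_of_injective e e.injective _ _ (fun i hi => ?_) fun a => ?_).symm
      · simp only [hout i hi, zero_smul]
      · simp only [e.injective.extend_apply]
  · rintro _ ⟨⟨w, z⟩, ⟨hw, hz⟩, rfl⟩
    exact (convex_convexHull ℝ s).sum_mem (fun i _ => hw.1 i) hw.2
      fun i _ => subset_convexHull ℝ s (hz i trivial)

/-! ### Geodesic segments and the Klein model -/

theorem mem_geodSegment_iff_lift {p q r : ℍ} : r ∈ geodSegment p q ↔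
    ∃ α β : ℝ, 0 ≤ α ∧ 0 ≤ β ∧ lift r = α • lift p + β • lift q := by
  constructor
  · intro h
    have h : dist p r + dist r q = dist p q := h
    rcases (dist_nonneg : 0 ≤ dist p q).eq_or_lt with h0 | h0
    · have hpr : dist p r = 0 := by
        have := dist_nonneg (x := p) (y := r)
        have := dist_nonneg (x := r) (y := q)
        linarith
      obtain rfl := dist_eq_zero.1 hpr
      exact ⟨1, 0, zero_le_one, le_rfl, by simp⟩
    have hS := Real.sinh_pos_iff.2 h0
    have ha := Real.sinh_nonneg_iff.2 (dist_nonneg (x := p) (y := r))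
    have hb := Real.sinh_nonneg_iff.2 (dist_nonneg (x := r) (y := q))
    refine ⟨Real.sinh (dist r q) / Real.sinh (dist p q), Real.sinh (dist p r) / Real.sinh (dist p q),
      by positivity, by positivity, ?_⟩
    have e1 : Real.sinh (dist p q) = Real.sinh (dist p r) * Real.cosh (dist r q) +
        Real.cosh (dist p r) * Real.sinh (dist r q) := by rw [← h, Real.sinh_add]
    have e2 : Real.sinh (dist r q) = Real.sinh (dist p q) * Real.cosh (dist p r) -
        Real.cosh (dist p q) * Real.sinh (dist p r) := by rw [← h, ← Real.sinh_sub]; ring_nf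
    have e3 : Real.sinh (dist p r) = Real.sinh (dist p q) * Real.cosh (dist r q) -
        Real.cosh (dist p q) * Real.sinh (dist r q) := by rw [← h, ← Real.sinh_sub]; ring_nf
    set α := Real.sinh (dist r q) / Real.sinh (dist p q) with hα
    set β := Real.sinh (dist p r) / Real.sinh (dist p q) with hβ
    -- The coefficients come from the sine rule for hyperbolic interpolation. The difference is
    -- orthogonal to all three lifts, hence to itself, hence zero.
    have hP : lform (lift r - (α • lift p + β • lift q)) (lift p) = 0 := by
      simp only [map_sub, map_add, map_smul, LinearMap.sub_apply, LinearMap.add_apply,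
        LinearMap.smul_apply, lform_lift, dist_self, Real.cosh_zero, smul_eq_mul,
        dist_comm r p, dist_comm q p, hα, hβ]
      field_simp
      linarith
    have hQ : lform (lift r - (α • lift p + β • lift q)) (lift q) = 0 := by
      simp only [map_sub, map_add, map_smul, LinearMap.sub_apply, LinearMap.add_apply,
        LinearMap.smul_apply, lform_lift, dist_self, Real.cosh_zero, smul_eq_mul, hα, hβ]
      field_simp
      linarith
    have hR : lform (lift r - (α • lift p + β • lift q)) (lift r) = 0 := by
      simp only [map_sub, map_add, map_smul, LinearMap.sub_apply, LinearMap.add_apply,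
        LinearMap.smul_apply, lform_lift, dist_self, Real.cosh_zero, smul_eq_mul, dist_comm q r,
        hα, hβ]
      field_simp
      linarith
    refine sub_eq_zero.1 (eq_zero_of_lform_nonneg p hP (le_of_eq ?_))
    rw [map_sub, map_add, map_smul, map_smul, hP, hQ, hR]
    simp
  · rintro ⟨α, β, hα, hβ, e⟩
    have h1 := lform_lift_self r
    have hp := lform_lift p r
    have hq := lform_lift r q
    rw [e] at h1 hp hq
    simp only [map_add, map_smul, LinearMap.add_apply,
        LinearMap.smul_apply, lform_lift, dist_self, Real.cosh_zero, smul_eq_mul,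
        dist_comm q p] at h1 hp hq
    have hS := Real.sinh_nonneg_iff.2 (dist_nonneg (x := p) (y := q))
    have hC := Real.cosh_sq (dist p q)
    have sp : Real.sinh (dist p r) = β * Real.sinh (dist p q) := by
      rw [← sq_eq_sq₀ (Real.sinh_nonneg_iff.2 dist_nonneg) (mul_nonneg hβ hS), Real.sinh_sq, ← hp]
      grind
    have sq : Real.sinh (dist r q) = α * Real.sinh (dist p q) := by
      rw [← sq_eq_sq₀ (Real.sinh_nonneg_iff.2 dist_nonneg) (mul_nonneg hα hS), Real.sinh_sq, ← hq]
      grind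
    refine Real.cosh_strictMonoOn.injOn (add_nonneg dist_nonneg dist_nonneg) dist_nonneg ?_
    rw [Real.cosh_add, sp, sq, ← hp, ← hq]
    grind

/-- The Klein model of the hyperbolic plane, as the region above a parabola. -/
def klein (z : ℍ) : ℝ × ℝ := (z.re, z.re ^ 2 + z.im ^ 2)

theorem klein_injective : Function.Injective klein := by
  intro z w h
  have h1 : z.re = w.re := congrArg Prod.fst h
  have h2 : z.re ^ 2 + z.im ^ 2 = w.re ^ 2 + w.im ^ 2 := congrArg Prod.snd h
  refine UpperHalfPlane.ext_re_im h1 ?_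
  rw [h1] at h2
  exact (sq_eq_sq₀ z.im_pos.le w.im_pos.le).1 (by linarith)

theorem range_klein : Set.range klein = {s : ℝ × ℝ | s.1 ^ 2 < s.2} := by
  ext s
  constructor
  · rintro ⟨z, rfl⟩
    have := z.im_pos
    simp only [klein, Set.mem_ofPred_eq]
    nlinarith
  · intro h
    have h : 0 < s.2 - s.1 ^ 2 := sub_pos.2 h
    refine ⟨⟨⟨s.1, √(s.2 - s.1 ^ 2)⟩, Real.sqrt_pos.2 h⟩, ?_⟩
    ext
    · rfl
    · change s.1 ^ 2 + √(s.2 - s.1 ^ 2) ^ 2 = s.2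
      rw [Real.sq_sqrt h.le]
      ring

theorem convex_range_klein : Convex ℝ (Set.range klein) := by
  rw [range_klein]
  simpa using (even_two.convexOn_pow (𝕜 := ℝ)).convex_strict_epigraph

/-- Dividing `lift z` by its first coordinate gives `(1, klein z)`, so cones over two lifts become
Euclidean segments. -/
theorem mem_geodSegment_iff_klein {p q r : ℍ} :
    r ∈ geodSegment p q ↔ klein r ∈ segment ℝ (klein p) (klein q) := by
  rw [mem_geodSegment_iff_lift]
  have hp := p.im_pos
  have hq := q.im_pos
  have hr := r.im_pos
  constructor
  · rintro ⟨α, β, hα, hβ, e⟩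
    have e0 := congrArg Prod.fst e
    have e1 := congrArg (fun z => z.2.1) e
    have e2 := congrArg (fun z => z.2.2) e
    simp only [lift, Prod.fst_add, Prod.snd_add, Prod.smul_fst, Prod.smul_snd, smul_eq_mul]
      at e0 e1 e2
    refine ⟨α * r.im / p.im, β * r.im / q.im, by positivity, by positivity, ?_, ?_⟩
    · field_simp at e0 ⊢
      linarith
    · ext
      · simp only [klein, Prod.fst_add, Prod.smul_fst, smul_eq_mul]
        field_simp at e1 ⊢
        linarith
      · simp only [klein, Prod.snd_add, Prod.smul_snd, smul_eq_mul]
        field_simp at e2 ⊢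
        linarith
  · rintro ⟨s, t, hs, ht, hst, e⟩
    have e1 := congrArg Prod.fst e
    have e2 := congrArg Prod.snd e
    simp only [klein, Prod.fst_add, Prod.snd_add, Prod.smul_fst, Prod.smul_snd, smul_eq_mul]
      at e1 e2
    refine ⟨s * p.im / r.im, t * q.im / r.im, by positivity, by positivity, ?_⟩
    simp only [lift, ← e2]
    rw [← e1]
    ext
    · simp only [Prod.fst_add, Prod.smul_fst, smul_eq_mul]
      field_simp
      linarith
    · simp only [Prod.fst_add, Prod.smul_fst, Prod.snd_add, Prod.smul_snd, smul_eq_mul]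
      field_simp
    · simp only [Prod.snd_add, Prod.smul_snd, smul_eq_mul]
      field_simp

theorem geodConvex_closedBall (z : ℍ) (ρ : ℝ) : GeodConvex (Metric.closedBall z ρ) := by
  intro p hp q hq r hr
  obtain ⟨α, β, hα, hβ, e⟩ := mem_geodSegment_iff_lift.1 hr
  rw [Metric.mem_closedBall] at *
  have hρ : 0 ≤ ρ := dist_nonneg.trans hp
  have h1 := lform_lift_self r
  have hz := lform_lift r z
  rw [e] at h1 hz
  simp only [map_add, map_smul, LinearMap.add_apply, LinearMap.smul_apply, lform_lift, dist_self,
    Real.cosh_zero, smul_eq_mul, dist_comm q p] at h1 hz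
  -- Since `lift r` has norm one, `1 = α² + β² + 2αβ cosh (dist p q) ≥ (α + β)²`.
  have hle : α + β ≤ 1 := by
    have := mul_nonneg (mul_nonneg hα hβ) (sub_nonneg.2 (Real.one_le_cosh (dist p q)))
    nlinarith
  have key : ∀ w : ℍ, dist w z ≤ ρ ↔ Real.cosh (dist w z) ≤ Real.cosh ρ := fun w => by
    rw [Real.cosh_le_cosh, abs_of_nonneg hρ, abs_of_nonneg dist_nonneg]
  rw [key] at *
  have h2 := mul_le_mul_of_nonneg_left hp hα
  have h3 := mul_le_mul_of_nonneg_left hq hβ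
  have h4 := mul_le_mul_of_nonneg_right hle (Real.cosh_pos ρ).le
  linarith

theorem hypConvexHull_eq (A : Set ℍ) :
    hypConvexHull A = klein ⁻¹' convexHull ℝ (klein '' A) := by
  apply Set.Subset.antisymm
  · refine Set.sInter_subset_of_mem ⟨fun p hp => subset_convexHull ℝ _ ⟨p, hp, rfl⟩, ?_⟩
    intro p hp q hq r hr
    exact (convex_convexHull ℝ _).segment_subset hp hq (mem_geodSegment_iff_klein.1 hr)
  · rintro r hr B ⟨hAB, hB⟩
    have hconv : Convex ℝ (klein '' B) := by
      rw [convex_iff_segment_subset]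
      rintro _ ⟨p, hp, rfl⟩ _ ⟨q, hq, rfl⟩ s hs
      obtain ⟨w, rfl⟩ := convex_range_klein.segment_subset ⟨p, rfl⟩ ⟨q, rfl⟩ hs
      exact ⟨w, hB p hp q hq (mem_geodSegment_iff_klein.2 hs), rfl⟩
    obtain ⟨w, hw, e⟩ := convexHull_min (Set.image_mono hAB) hconv hr
    rwa [← klein_injective e]

theorem continuous_klein : Continuous klein :=
  UpperHalfPlane.continuous_re.prodMk
    ((UpperHalfPlane.continuous_re.pow 2).add (UpperHalfPlane.continuous_im.pow 2))

theorem isClosed_hypConvexHull {A : Set ℍ} (hA : IsCompact A) : IsClosed (hypConvexHull A) := by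
  rw [hypConvexHull_eq]
  exact (isCompact_convexHull (hA.image continuous_klein)).isClosed.preimage continuous_klein

theorem hypConvexHull_subset {A B : Set ℍ} (h : A ⊆ B) (hB : GeodConvex B) :
    hypConvexHull A ⊆ B := Set.sInter_subset_of_mem ⟨h, hB⟩

/-! ### Extension to one more point -/

theorem sum_mul_lform_tlift_le {ι : Type*} [Fintype ι] {k : ℝ} (hk : 0 ≤ k) (x : ι → TangentH)
    (hx : ∀ i j, rate (x i) (x j) ≤
      k * (dist (x i).1 (x j).1 * Real.sinh (dist (x i).1 (x j).1)))
    {p : ℍ} (hp : ∀ i, p ≠ (x i).1) {μ : ι → ℝ} (hμ : ∀ i, 0 ≤ μ i) {m : ℝ} (hm : 0 < m)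
    (h : ∑ i, μ i • lift (x i).1 = m • lift p) :
    ∑ i, μ i * lform (lift p) (tlift (x i)) ≤
      k * ∑ i, μ i * (dist p (x i).1 * Real.sinh (dist p (x i).1)) := by
  have hsum : ∀ V, ∑ i, μ i * lform V (lift (x i).1) = m * lform V (lift p) := by
    intro V
    have := congrArg (lform V) h
    simpa only [map_sum, map_smul, smul_eq_mul] using this
  set Φ : ι → ℝ := fun i => dist p (x i).1 / Real.sinh (dist p (x i).1) with hΦ
  set c : ι → ℝ := fun i => lform (lift p) (lift (x i).1) with hc
  set g : ι → ι → ℝ := fun i j =>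
    dist (x i).1 (x j).1 * Real.sinh (dist (x i).1 (x j).1) with hg
  -- By the hyperbolic law of cosines `e i j` is `a * sinh c * cos α`, with `a = dist p (x i).1`,
  -- `c` the distance from `x i` to `x j`, and `α` the angle at `x i`.
  set e : ι → ι → ℝ := fun i j => Φ i * (c i * lform (lift (x i).1) (lift (x j).1) - c j) with he
  have htri : ∀ i j, g i j ≤ e i j + e j i := by
    intro i j
    have := mul_sinh_le_of_triangle (dist_pos.2 (hp i)) (dist_pos.2 (hp j))
      (c := dist (x i).1 (x j).1)
      (by
        rw [abs_le]
        have h1 := dist_triangle p (x i).1 (x j).1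
        have h2 := dist_triangle p (x j).1 (x i).1
        rw [dist_comm (x j).1] at h2
        constructor <;> linarith)
      (by
        have := dist_triangle (x i).1 p (x j).1
        rwa [dist_comm (x i).1 p] at this)
    simpa only [he, hΦ, hc, hg, lform_lift, dist_comm (x j).1 (x i).1] using this
  have hrate : ∑ i, ∑ j, μ i * μ j * rate (x i) (x j) =
      2 * m * ∑ i, μ i * lform (lift p) (tlift (x i)) := by
    have h1 : ∑ i, ∑ j, μ i * μ j * lform (tlift (x i)) (lift (x j).1) =
        m * ∑ i, μ i * lform (lift p) (tlift (x i)) := by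
      rw [Finset.mul_sum]
      refine Finset.sum_congr rfl fun i _ => ?_
      have := congrArg (μ i * ·) (hsum (tlift (x i)))
      simp only [Finset.mul_sum] at this
      rw [lform_comm (lift p), mul_left_comm, ← this]
      exact Finset.sum_congr rfl fun j _ => by ring
    have h2 : ∑ i, ∑ j, μ i * μ j * lform (lift (x i).1) (tlift (x j)) =
        m * ∑ i, μ i * lform (lift p) (tlift (x i)) := by
      rw [Finset.sum_comm, ← h1]
      refine Finset.sum_congr rfl fun i _ => Finset.sum_congr rfl fun j _ => ?_
      rw [lform_comm (tlift _), mul_comm (μ i)]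
    simp only [rate, mul_add, Finset.sum_add_distrib, h1, h2]
    ring
  have hcomp : ∑ i, ∑ j, μ i * μ j * (e i j + e j i) =
      2 * m * ∑ i, μ i * (dist p (x i).1 * Real.sinh (dist p (x i).1)) := by
    have h1 : ∑ i, ∑ j, μ i * μ j * e i j =
        m * ∑ i, μ i * (dist p (x i).1 * Real.sinh (dist p (x i).1)) := by
      rw [Finset.mul_sum]
      refine Finset.sum_congr rfl fun i _ => ?_
      -- The barycenter relation `h` turns the inner bracket into `m * (cosh² - 1) = m * sinh²` of
      -- `dist p (x i).1`, so nothing is lost in this sum.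
      have h3 : ∑ j, μ i * μ j * e i j = μ i * Φ i *
          (c i * ∑ j, μ j * lform (lift (x i).1) (lift (x j).1) -
            ∑ j, μ j * lform (lift p) (lift (x j).1)) := by
        rw [Finset.mul_sum, ← Finset.sum_sub_distrib, Finset.mul_sum]
        exact Finset.sum_congr rfl fun j _ => by simp only [he, hc]; ring
      rw [h3, hsum, hsum, lform_comm (lift (x i).1)]
      simp only [hc, hΦ, lform_lift, dist_self, Real.cosh_zero]
      have hs := (Real.sinh_pos_iff.2 (dist_pos.2 (hp i))).ne'
      have hcs := Real.cosh_sq (dist p (x i).1)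
      field_simp
      linear_combination (μ i * dist p (x i).1) * hcs
    have h2 : ∑ i, ∑ j, μ i * μ j * e j i =
        m * ∑ i, μ i * (dist p (x i).1 * Real.sinh (dist p (x i).1)) := by
      rw [Finset.sum_comm, ← h1]
      exact Finset.sum_congr rfl fun i _ => Finset.sum_congr rfl fun j _ => by ring
    simp only [mul_add, Finset.sum_add_distrib, h1, h2]
    ring
  have hle : ∑ i, ∑ j, μ i * μ j * rate (x i) (x j) ≤
      k * ∑ i, ∑ j, μ i * μ j * (e i j + e j i) := by
    simp only [Finset.mul_sum]
    refine Finset.sum_le_sum fun i _ => Finset.sum_le_sum fun j _ => ?_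
    have h1 := mul_le_mul_of_nonneg_left (hx i j) (mul_nonneg (hμ i) (hμ j))
    have h2 := mul_le_mul_of_nonneg_left (htri i j) (mul_nonneg hk (mul_nonneg (hμ i) (hμ j)))
    simp only [hg] at h2
    linarith
  rw [hrate, hcomp] at hle
  refine le_of_mul_le_mul_left ?_ (show 0 < 2 * m by positivity)
  linarith

/-- The slack `ε` supplies the strict positivity that the duality lemma asks for; it is removed
later by compactness. -/
theorem exists_rate_le_add {N : Set TangentH} {k : ℝ} (hk : 0 ≤ k) (hN : IsLip k N) {p : ℍ}
    (hp : ∀ x ∈ N, p ≠ x.1) (S : Finset TangentH) (hS : ↑S ⊆ N) {ε : ℝ} (hε : 0 < ε) :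
    ∃ v : ℂ, ∀ x ∈ S,
      rate (p, v) x ≤ k * (dist p x.1 * Real.sinh (dist p x.1)) + ε := by
  rw [isLip_iff] at hN
  let a : S → ℂ := fun x => ⟨lform (tlift (p, 1)) (lift x.1.1),
    lform (tlift (p, Complex.I)) (lift x.1.1)⟩
  have ha : ∀ v x, inner ℝ v (a x) = lform (tlift (p, v)) (lift x.1.1) := by
    intro v x
    have hv : v = v.re • (1 : ℂ) + v.im • Complex.I := by
      simp
    conv_rhs => rw [hv, tlift_add, tlift_smul, tlift_smul]
    simp only [map_add, map_smul, LinearMap.add_apply, LinearMap.smul_apply, smul_eq_mul,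
      Complex.inner, Complex.mul_re, Complex.conj_re, Complex.conj_im, a]
    ring
  obtain ⟨v, hv⟩ := exists_forall_le_of_stdSimplex a
    (fun x => k * (dist p x.1.1 * Real.sinh (dist p x.1.1)) + ε - lform (lift p) (tlift x.1)) (by
      rintro μ ⟨hμ, hμ1⟩ h0
      set V := ∑ x : S, μ x • lift x.1.1 with hV
      set m := lform V (lift p) with hm
      have horth : ∀ w, lform (tlift (p, w)) V = 0 := by
        intro w
        have := congrArg (inner ℝ w) h0
        simpa only [inner_sum, inner_zero_right, inner_smul_right, ha, hV, map_sum, map_smul,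
          smul_eq_mul] using this
      have hm0 : 0 < m := by
        have h1 : ∑ x : S, μ x * 1 ≤ m := by
          simp only [hm, hV, map_sum, map_smul, LinearMap.sum_apply, LinearMap.smul_apply,
            smul_eq_mul]
          exact Finset.sum_le_sum fun x _ =>
            mul_le_mul_of_nonneg_left (one_le_lform_lift _ _) (hμ x)
        simp only [mul_one, hμ1] at h1
        linarith
      -- A vanishing combination of the constraints makes `V` orthogonal to the tangent plane at
      -- `p`, hence a multiple of `lift p`.
      have hVp : lform (V - m • lift p) (lift p) = 0 := by
        simp only [map_sub, map_smul, LinearMap.sub_apply, LinearMap.smul_apply, lform_lift_self,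
          smul_eq_mul, ← hm]
        ring
      have hVm : V = m • lift p := by
        refine sub_eq_zero.1 (eq_zero_of_lform_nonneg p hVp (le_of_eq ?_))
        obtain ⟨w, hw⟩ := exists_tlift_eq p _ hVp
        rw [map_sub, map_smul, hVp, ← hw, horth]
        simp
      have key := sum_mul_lform_tlift_le hk (fun x : S => x.1)
        (fun i j => hN _ (hS i.2) _ (hS j.2)) (fun i => hp _ (hS i.2)) hμ hm0 hVm
      have e : ∑ x : S, μ x * (k * (dist p x.1.1 * Real.sinh (dist p x.1.1)) + ε -
          lform (lift p) (tlift x.1)) =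
          k * ∑ x : S, μ x * (dist p x.1.1 * Real.sinh (dist p x.1.1)) + (∑ x : S, μ x) * ε -
            ∑ x : S, μ x * lform (lift p) (tlift x.1) := by
        rw [Finset.mul_sum, Finset.sum_mul, ← Finset.sum_add_distrib, ← Finset.sum_sub_distrib]
        exact Finset.sum_congr rfl fun x _ => by ring
      rw [e, hμ1]
      linarith)
  refine ⟨v, fun x hx => ?_⟩
  have := hv ⟨x, hx⟩
  rw [ha] at this
  simp only [rate]
  linarith

/-! ### A contracting field on an annulus -/

/-- The vector field over the annulus `ρ + 1 ≤ dist z o ≤ 3 * ρ + 1` that points to the center `o`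
and has norm `c * sinh (dist z o)`. -/
def inwardField (o : ℍ) (ρ c : ℝ) : Set TangentH :=
  {x | ρ + 1 ≤ dist x.1 o ∧ dist x.1 o ≤ 3 * ρ + 1 ∧
    tlift x = c • (lift o - lform (lift o) (lift x.1) • lift x.1)}

theorem exists_mem_inwardField {o : ℍ} {ρ : ℝ} (c : ℝ) {z : ℍ} (h1 : ρ + 1 ≤ dist z o)
    (h2 : dist z o ≤ 3 * ρ + 1) : ∃ w, (z, w) ∈ inwardField o ρ c := by
  obtain ⟨w, hw⟩ := exists_tlift_eq z (c • (lift o - lform (lift o) (lift z) • lift z)) (by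
    simp only [map_sub, map_smul, LinearMap.sub_apply, LinearMap.smul_apply, lform_lift_self,
      smul_eq_mul]
    ring)
  exact ⟨w, h1, h2, hw⟩

theorem lform_tlift_of_mem_inwardField {o : ℍ} {ρ c : ℝ} {x : TangentH}
    (hx : x ∈ inwardField o ρ c) (z : ℍ) : lform (tlift x) (lift z) =
      c * (Real.cosh (dist z o) - Real.cosh (dist x.1 o) * Real.cosh (dist x.1 z)) := by
  rw [hx.2.2]
  simp only [map_sub, map_smul, LinearMap.sub_apply, LinearMap.smul_apply, smul_eq_mul, lform_lift,
    dist_comm o]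

theorem rate_inwardField_nonpos {o : ℍ} {ρ c : ℝ} (hc : 0 ≤ c) {x y : TangentH}
    (hx : x ∈ inwardField o ρ c) (hy : y ∈ inwardField o ρ c) : rate x y ≤ 0 := by
  rw [rate, lform_comm (lift x.1), lform_tlift_of_mem_inwardField hx,
    lform_tlift_of_mem_inwardField hy, dist_comm y.1 x.1]
  have h1 := Real.cosh_pos (dist x.1 o)
  have h2 := Real.cosh_pos (dist y.1 o)
  have h3 := Real.one_le_cosh (dist x.1 y.1)
  have := mul_nonneg (mul_nonneg hc (add_pos h1 h2).le) (sub_nonneg.2 h3)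
  linarith

theorem exists_isLip_union_inwardField {X : Set TangentH} (hX : IsCompact X) {k : ℝ} (hk : 0 ≤ k)
    (hXk : IsLip k X) {o : ℍ} {ρ : ℝ} (hρ : 0 ≤ ρ) (hXρ : ∀ x ∈ X, dist x.1 o ≤ ρ) :
    ∃ c, 0 ≤ c ∧ IsLip k (X ∪ inwardField o ρ c) := by
  have hcont : Continuous fun z : TangentH × ℍ => lform (tlift z.1) (lift z.2) :=
    continuous_lform.comp ((continuous_tlift.comp continuous_fst).prodMk
      (continuous_lift.comp continuous_snd))
  obtain ⟨K, hK⟩ := (hX.prod (isCompact_closedBall o (3 * ρ + 1))).bddAbove_image hcont.continuousOn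
  have hδ : 0 < Real.cosh (ρ + 1) - Real.cosh ρ := by
    rw [sub_pos, Real.cosh_lt_cosh, abs_of_nonneg hρ, abs_of_nonneg (by linarith)]
    linarith
  set δ := Real.cosh (ρ + 1) - Real.cosh ρ
  -- Against a vector of `X` the inward field contributes at most `-c * δ`, and the vector of `X` at
  -- most `K`.
  refine ⟨|K| / δ, by positivity, ?_⟩
  have hcross : ∀ x ∈ inwardField o ρ (|K| / δ), ∀ y ∈ X, rate x y ≤ 0 := by
    intro x hx y hy
    have h1 : lform (tlift y) (lift x.1) ≤ K := hK ⟨(y, x.1), ⟨hy, hx.2.1⟩, rfl⟩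
    rw [rate, lform_comm (lift x.1), lform_tlift_of_mem_inwardField hx]
    have h2 : Real.cosh (dist y.1 o) ≤ Real.cosh ρ := by
      rw [Real.cosh_le_cosh, abs_of_nonneg dist_nonneg, abs_of_nonneg hρ]
      exact hXρ y hy
    have h3 : Real.cosh (ρ + 1) ≤ Real.cosh (dist x.1 o) := by
      rw [Real.cosh_le_cosh, abs_of_nonneg dist_nonneg, abs_of_nonneg (by linarith)]
      exact hx.1
    have h4 := Real.one_le_cosh (dist x.1 y.1)
    have h5 : Real.cosh (dist x.1 o) * 1 ≤ Real.cosh (dist x.1 o) * Real.cosh (dist x.1 y.1) :=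
      mul_le_mul_of_nonneg_left h4 (Real.cosh_pos _).le
    have h6 : Real.cosh (dist y.1 o) - Real.cosh (dist x.1 o) * Real.cosh (dist x.1 y.1) ≤ -δ := by
      simp only [δ]
      linarith
    have h7 := mul_le_mul_of_nonneg_left h6 (show 0 ≤ |K| / δ by positivity)
    have h8 : |K| / δ * -δ = -|K| := by field_simp
    linarith [le_abs_self K]
  have hnn : ∀ x y : TangentH, 0 ≤ k * (dist x.1 y.1 * Real.sinh (dist x.1 y.1)) := fun x y =>
    mul_nonneg hk (mul_nonneg dist_nonneg (Real.sinh_nonneg_iff.2 dist_nonneg))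
  rw [isLip_iff] at hXk ⊢
  rintro x (hx | hx) y (hy | hy)
  · exact hXk x hx y hy
  · rw [rate_comm]
    exact (hcross y hy x hx).trans (hnn x y)
  · exact (hcross x hx y hy).trans (hnn x y)
  · exact (rate_inwardField_nonpos (by positivity) hx hy).trans (hnn x y)

/-- Vectors in a ball that are compatible with the inward field on an annulus around the ball are
bounded. -/
theorem exists_inner_le {k c ρ : ℝ} (hk : 0 ≤ k) (hc : 0 ≤ c) (hρ : 0 ≤ ρ) (o : ℍ) :
    ∃ K : ℝ, ∀ p ∈ Metric.closedBall o ρ, ∀ u : ℂ, ‖u‖ = 1 → ∃ w ∈ inwardField o ρ c,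
      ∀ v : ℂ, rate (p, v) w ≤ k * (dist p w.1 * Real.sinh (dist p w.1)) + 1 →
        inner ℝ v u ≤ K := by
  -- A step of length `s` from a point of the ball always lands in the annulus. Stepping along `-u`
  -- makes the component of `v` along `u` stretch the distance to the landing point, which bounds
  -- that component.
  set s := 2 * ρ + 1 with hs
  have hs0 : 0 < Real.sinh s := Real.sinh_pos_iff.2 (by positivity)
  set K := k * (s * Real.sinh s) + 1 + c * (Real.cosh (3 * ρ + 1) * Real.cosh s) with hK
  have hK0 : 0 ≤ K := by positivity
  refine ⟨K * (o.im * Real.exp ρ) / Real.sinh s, fun p hp u hu => ?_⟩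
  rw [Metric.mem_closedBall] at hp
  have hpi := p.im_pos
  have hn : hypNorm (p, u) = 1 / p.im := by simp only [hypNorm, hu]
  have hu0 : u ≠ 0 := by
    rintro rfl
    simp at hu
  set z := hypExp (p, ((-(s * p.im) : ℝ) : ℂ) * u) with hz
  have hdz : dist p z = s := by
    have := dist_hypExp_smul p u 0 (-(s * p.im))
    rw [Complex.ofReal_zero, zero_mul, hypExp_zero, ← hz, hn, zero_sub, neg_neg,
      abs_of_nonneg (by positivity)] at this
    rw [this]
    field_simp
  have hlz : lift z = Real.cosh s • lift p - (Real.sinh s * p.im) • tlift (p, u) := by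
    have e : -(s * p.im) * (1 / p.im) = -s := by field_simp
    rw [hz, lift_hypExp p hu0, hn, e, Real.cosh_neg, Real.sinh_neg, div_div_eq_mul_div, div_one,
      neg_mul, neg_smul, sub_eq_add_neg]
  have hzo : dist z o ≤ 3 * ρ + 1 := by
    have := dist_triangle z p o
    rw [dist_comm z p] at this
    linarith
  obtain ⟨w, hw⟩ := exists_mem_inwardField c (z := z) (o := o) (ρ := ρ) (by
    have := dist_triangle p o z
    rw [dist_comm o z] at this
    linarith) hzo
  refine ⟨(z, w), hw, fun v hv => ?_⟩
  rw [rate, lform_comm (lift p), lform_tlift_of_mem_inwardField hw, hlz, map_sub, map_smul, map_smul,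
    lform_tlift_lift_self, lform_tlift_tlift, hdz, dist_comm z p, hdz] at hv
  have h1 : Real.cosh (dist z o) ≤ Real.cosh (3 * ρ + 1) := by
    rw [Real.cosh_le_cosh, abs_of_nonneg dist_nonneg, abs_of_nonneg (by positivity)]
    exact hzo
  have h2 := mul_le_mul_of_nonneg_left
    (mul_le_mul_of_nonneg_right h1 (Real.cosh_pos s).le) hc
  have h3 := mul_nonneg hc (Real.cosh_pos (dist p o)).le
  have h4 : inner ℝ v u * (Real.sinh s / p.im) ≤ K := by
    have e : inner ℝ v u * (Real.sinh s / p.im) =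
        Real.cosh s • (0 : ℝ) - (Real.sinh s * p.im) • (-inner ℝ v u / p.im ^ 2) := by
      simp only [smul_eq_mul]
      field_simp
      ring
    rw [e]
    simp only [hK]
    linarith
  have h5 : p.im ≤ o.im * Real.exp ρ :=
    (UpperHalfPlane.im_le_im_mul_exp_dist p o).trans
      (mul_le_mul_of_nonneg_left (Real.exp_le_exp.2 hp) o.im_pos.le)
  rw [le_div_iff₀ hs0]
  calc inner ℝ v u * Real.sinh s = inner ℝ v u * (Real.sinh s / p.im) * p.im := by field_simp
    _ ≤ K * p.im := mul_le_mul_of_nonneg_right h4 hpi.le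
    _ ≤ K * (o.im * Real.exp ρ) := mul_le_mul_of_nonneg_left h5 hK0

theorem exists_finset_norm_le : ∃ U : Finset ℂ, (∀ u ∈ U, ‖u‖ = 1) ∧
    ∀ (v : ℂ) (K : ℝ), (∀ u ∈ U, inner ℝ v u ≤ K) → ‖v‖ ≤ 2 * K := by
  refine ⟨{1, -1, Complex.I, -Complex.I}, fun u hu => ?_, fun v K h => ?_⟩
  · simp only [Finset.mem_insert, Finset.mem_singleton] at hu
    rcases hu with rfl | rfl | rfl | rfl <;> simp
  · simp only [Finset.mem_insert, Finset.mem_singleton, forall_eq_or_imp, forall_eq, Complex.inner,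
      Complex.mul_re, Complex.conj_re, Complex.conj_im, Complex.neg_re, Complex.neg_im,
      Complex.one_re, Complex.one_im, Complex.I_re, Complex.I_im] at h
    obtain ⟨h1, h2, h3, h4⟩ := h
    have h5 : |v.re| ≤ K := abs_le.2 ⟨by linarith, by linarith⟩
    have h6 : |v.im| ≤ K := abs_le.2 ⟨by linarith, by linarith⟩
    linarith [Complex.norm_le_abs_re_add_abs_im v]

theorem continuous_rate_left (p : ℍ) (y : TangentH) : Continuous fun v : ℂ => rate (p, v) y := by
  have h : Continuous fun v : ℂ => (((p, v), y) : TangentH × TangentH) := by fun_prop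
  have h' := continuous_rate.comp h
  exact h'

theorem exists_rate_le {N : Set TangentH} {k : ℝ} (hk : 0 ≤ k) (hN : IsLip k N) {o p : ℍ}
    {ρ c : ℝ} (hc : 0 ≤ c) (hρ : 0 ≤ ρ) (hcN : inwardField o ρ c ⊆ N)
    (hpρ : p ∈ Metric.closedBall o ρ) (hp : ∀ x ∈ N, p ≠ x.1) :
    ∃ v : ℂ, ∀ x ∈ N, rate (p, v) x ≤ k * (dist p x.1 * Real.sinh (dist p x.1)) := by
  classical
  obtain ⟨K, hK⟩ := exists_inner_le hk hc hρ o
  choose! w hw hwK using hK p hpρ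
  obtain ⟨U, hU, hUK⟩ := exists_finset_norm_le
  let t : N × ℕ → Set ℂ := fun i => {v | rate (p, v) i.1 ≤
    k * (dist p i.1.1.1 * Real.sinh (dist p i.1.1.1)) + 1 / ((i.2 : ℝ) + 1)}
  have ht : ∀ i, IsClosed (t i) := fun i =>
    isClosed_le (continuous_rate_left p i.1) continuous_const
  obtain ⟨v, -, hv⟩ := (isCompact_closedBall (0 : ℂ) (2 * K)).inter_iInter_nonempty t ht (by
    intro S
    let n := S.sup Prod.snd
    have hn : 0 < 1 / ((n : ℝ) + 1) := by positivity
    have hn1 : 1 / ((n : ℝ) + 1) ≤ 1 := by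
      rw [div_le_one (by positivity)]
      linarith [(Nat.cast_nonneg n : (0 : ℝ) ≤ n)]
    -- Adding the barrier vectors `w u` to each finite subsystem keeps its solutions in one fixed
    -- ball. The slack is at most `1`, as `exists_inner_le` allows.
    obtain ⟨v, hv⟩ := exists_rate_le_add hk hN hp
      (S.image (fun i => (i.1 : TangentH)) ∪ U.image w)
      (by
        intro x hx
        simp only [Finset.coe_union, Finset.coe_image] at hx
        rcases hx with ⟨i, -, rfl⟩ | ⟨u, hu, rfl⟩
        · exact i.1.2
        · exact hcN (hw u (hU u hu))) hn
    refine ⟨v, ?_, ?_⟩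
    · rw [mem_closedBall_zero_iff]
      refine hUK v K fun u hu => hwK u (hU u hu) v ?_
      have := hv (w u) (Finset.mem_union_right _ (Finset.mem_image_of_mem w hu))
      linarith
    · refine Set.mem_iInter₂.2 fun i hi => ?_
      have h1 := hv i.1 (Finset.mem_union_left _ (Finset.mem_image_of_mem
        (fun i : N × ℕ => (i.1 : TangentH)) hi))
      have h2 : i.2 ≤ n := Finset.le_sup (f := Prod.snd) hi
      have h3 : 1 / ((n : ℝ) + 1) ≤ 1 / ((i.2 : ℝ) + 1) :=
        Nat.one_div_le_one_div h2
      change rate (p, v) i.1 ≤ _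
      linarith)
  refine ⟨v, fun x hx => ?_⟩
  have hlim : Filter.Tendsto (fun n : ℕ => k * (dist p x.1 * Real.sinh (dist p x.1)) +
      1 / ((n : ℝ) + 1)) Filter.atTop (nhds (k * (dist p x.1 * Real.sinh (dist p x.1)) + 0)) :=
    tendsto_const_nhds.add tendsto_one_div_add_atTop_nhds_zero_nat
  rw [add_zero] at hlim
  exact ge_of_tendsto' hlim fun n => Set.mem_iInter.1 hv (⟨x, hx⟩, n)

/-! ### Operations that preserve the Lipschitz condition -/

theorem IsLip.mono {k : ℝ} {X Y : Set TangentH} (hY : IsLip k Y) (h : X ⊆ Y) : IsLip k X :=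
  fun x hx y hy => hY x (h hx) y (h hy)

theorem IsLip.closure {k : ℝ} {N : Set TangentH} (hN : IsLip k N) : IsLip k (closure N) := by
  rw [isLip_iff] at *
  have hd : Continuous fun z : TangentH × TangentH => dist z.1.1 z.2.1 :=
    (continuous_fst.comp continuous_fst).dist (continuous_fst.comp continuous_snd)
  have hd' : Continuous fun z : TangentH × TangentH =>
      k * (dist z.1.1 z.2.1 * Real.sinh (dist z.1.1 z.2.1)) := by
    have := Real.continuous_sinh.comp hd
    exact continuous_const.mul (hd.mul this)
  have hcl := isClosed_le continuous_rate hd'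
  have hsub : N ×ˢ N ⊆ {z : TangentH × TangentH | rate z.1 z.2 ≤
      k * (dist z.1.1 z.2.1 * Real.sinh (dist z.1.1 z.2.1))} :=
    fun z hz => hN z.1 hz.1 z.2 hz.2
  intro x hx y hy
  have hmem : (x, y) ∈ _root_.closure (N ×ˢ N) := by
    rw [closure_prod_eq]
    exact ⟨hx, hy⟩
  have hxy := closure_minimal hsub hcl hmem
  rwa [Set.mem_ofPred_eq] at hxy

/-- The fiberwise convex hull. -/
def fiberHull (N : Set TangentH) : Set TangentH := {x | x.2 ∈ convexHull ℝ (fiber N x.1)}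

theorem subset_fiberHull (N : Set TangentH) : N ⊆ fiberHull N := fun _ hx =>
  subset_convexHull ℝ _ hx

theorem fiberHull_mono {M N : Set TangentH} (h : M ⊆ N) : fiberHull M ⊆ fiberHull N :=
  fun x hx => convexHull_mono (show fiber M x.1 ⊆ fiber N x.1 from fun _ hv => h hv) hx

theorem convex_setOf_rate_le (p : ℍ) (y : TangentH) (c : ℝ) :
    Convex ℝ {v : ℂ | rate (p, v) y ≤ c} := by
  intro v hv w hw a b ha hb hab
  have hv : rate (p, v) y ≤ c := hv
  have hw : rate (p, w) y ≤ c := hw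
  change rate (p, a • v + b • w) y ≤ c
  have e : rate (p, a • v + b • w) y = a * rate (p, v) y + b * rate (p, w) y := by
    simp only [rate, tlift_add, tlift_smul, map_add, map_smul, LinearMap.add_apply,
      LinearMap.smul_apply, smul_eq_mul]
    linear_combination -lform (lift p) (tlift y) * hab
  rw [e]
  have h1 := mul_le_mul_of_nonneg_left hv ha
  have h2 := mul_le_mul_of_nonneg_left hw hb
  have h3 : a * c + b * c = c := by rw [← add_mul, hab, one_mul]
  linarith

theorem IsLip.fiberHull {k : ℝ} {N : Set TangentH} (hN : IsLip k N) :
    IsLip k (fiberHull N) := by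
  rw [isLip_iff] at *
  have h1 : ∀ x ∈ HypConvexField.fiberHull N, ∀ y ∈ N,
      rate x y ≤ k * (dist x.1 y.1 * Real.sinh (dist x.1 y.1)) := by
    intro x hx y hy
    have hsub : fiber N x.1 ⊆ {v | rate (x.1, v) y ≤
        k * (dist x.1 y.1 * Real.sinh (dist x.1 y.1))} := fun v hv => hN (x.1, v) hv y hy
    exact convexHull_min hsub (convex_setOf_rate_le x.1 y _) hx
  intro x hx y hy
  rw [rate_comm]
  have hsub : fiber N y.1 ⊆ {v | rate (y.1, v) x ≤
      k * (dist x.1 y.1 * Real.sinh (dist x.1 y.1))} := by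
    intro v hv
    rw [Set.mem_ofPred_eq, rate_comm]
    exact h1 x hx (y.1, v) hv
  exact convexHull_min hsub (convex_setOf_rate_le y.1 x _) hy

theorem domain_eq_image (X : Set TangentH) : domain X = Prod.fst '' X := by
  ext p
  constructor
  · rintro ⟨v, hv⟩
    exact ⟨(p, v), hv, rfl⟩
  · rintro ⟨x, hx, rfl⟩
    exact ⟨x.2, hx⟩

/-! ### Maximal extensions -/

/-- The extensions of `X` over subsets of the closed ball of radius `ρ` around `o` that are
`k`-lipschitz together with an auxiliary field `A`. -/
structure IsAdmissible (X A : Set TangentH) (k : ℝ) (o : ℍ) (ρ : ℝ) (M : Set TangentH) : Prop where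
  subset : X ⊆ M
  isLip : IsLip k (M ∪ A)
  dist_le : ∀ x ∈ M, dist x.1 o ≤ ρ
  mem_of_interior : ∀ x ∈ M, x.1 ∈ interior (domain X) → x ∈ X

variable {X A M : Set TangentH} {k : ℝ} {o : ℍ} {ρ : ℝ}

theorem IsAdmissible.closure (hX : IsClosed X) (hM : IsAdmissible X A k o ρ M) :
    IsAdmissible X A k o ρ (closure M) where
  subset := hM.subset.trans subset_closure
  isLip := hM.isLip.closure.mono (Set.union_subset (closure_mono Set.subset_union_left)
    (Set.subset_union_right.trans subset_closure))
  dist_le := by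
    have hcl : IsClosed {x : TangentH | dist x.1 o ≤ ρ} :=
      isClosed_le (continuous_fst.dist continuous_const) continuous_const
    exact fun x hx => closure_minimal hM.dist_le hcl hx
  mem_of_interior := by
    intro x hx hxi
    have hop : IsOpen (Prod.fst ⁻¹' interior (domain X) : Set TangentH) :=
      isOpen_interior.preimage continuous_fst
    -- Over an open set, points of the closure are limits of points of `M` over the same set, and
    -- those lie in the closed set `X`.
    have h1 : x ∈ _root_.closure (M ∩ Prod.fst ⁻¹' interior (domain X)) :=
      hop.closure_inter ⟨hx, hxi⟩
    exact closure_minimal (fun y hy => hM.mem_of_interior y hy.1 hy.2) hX h1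

theorem IsAdmissible.fiberHull (hX : IsConvexField X) (hM : IsAdmissible X A k o ρ M) :
    IsAdmissible X A k o ρ (fiberHull M) where
  subset := hM.subset.trans (subset_fiberHull M)
  isLip := hM.isLip.fiberHull.mono (Set.union_subset (fiberHull_mono Set.subset_union_left)
    (Set.subset_union_right.trans (subset_fiberHull _)))
  dist_le := by
    intro x hx
    obtain ⟨v, hv⟩ := convexHull_nonempty_iff.1 ⟨_, hx⟩
    exact hM.dist_le (x.1, v) hv
  mem_of_interior := by
    intro x hx hxi
    exact convexHull_min (fun v hv => hM.mem_of_interior (x.1, v) hv hxi) (hX.2 x.1) hx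

theorem exists_maximal_isAdmissible (h : IsAdmissible X A k o ρ X) :
    ∃ M, Maximal (IsAdmissible X A k o ρ) M := by
  obtain ⟨M, -, hM⟩ := zorn_subset_nonempty {M | IsAdmissible X A k o ρ M} (by
    intro c hc hchain hne
    refine ⟨⋃₀ c, ?_, fun s hs => Set.subset_sUnion_of_mem hs⟩
    refine ⟨?_, ?_, ?_, ?_⟩
    · obtain ⟨s, hs⟩ := hne
      exact (hc hs).subset.trans (Set.subset_sUnion_of_mem hs)
    · have hmem : ∀ x ∈ ⋃₀ c ∪ A, ∃ s ∈ c, x ∈ s ∪ A := by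
        rintro x (⟨s, hs, hx⟩ | hx)
        · exact ⟨s, hs, Or.inl hx⟩
        · obtain ⟨s, hs⟩ := hne
          exact ⟨s, hs, Or.inr hx⟩
      intro x hx y hy
      obtain ⟨s, hs, hxs⟩ := hmem x hx
      obtain ⟨t, ht, hyt⟩ := hmem y hy
      obtain ⟨u, hu, hsu, htu⟩ := hchain.directedOn s hs t ht
      exact (hc hu).isLip x (Set.union_subset_union_left A hsu hxs) y
        (Set.union_subset_union_left A htu hyt)
    · rintro x ⟨s, hs, hx⟩
      exact (hc hs).dist_le x hx
    · rintro x ⟨s, hs, hx⟩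
      exact (hc hs).mem_of_interior x hx) X h
  exact ⟨M, hM⟩

theorem IsAdmissible.exists_insert {c : ℝ} (hk : 0 ≤ k) (hc : 0 ≤ c) (hρ : 0 ≤ ρ)
    (hM : IsAdmissible X (inwardField o ρ c) k o ρ M) {p : ℍ} (hp : dist p o ≤ ρ)
    (hpM : p ∉ domain M) :
    ∃ v, IsAdmissible X (inwardField o ρ c) k o ρ (insert (p, v) M) := by
  have hne : ∀ x ∈ M ∪ inwardField o ρ c, p ≠ x.1 := by
    rintro x (hx | hx) rfl
    · exact hpM ⟨x.2, hx⟩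
    · linarith [hx.1]
  obtain ⟨v, hv⟩ := exists_rate_le hk hM.isLip hc hρ Set.subset_union_right hp hne
  refine ⟨v, hM.subset.trans (Set.subset_insert _ _), ?_, ?_, ?_⟩
  · have hlip := hM.isLip
    rw [isLip_iff] at hlip ⊢
    rw [Set.insert_union]
    rintro x (rfl | hx) y (rfl | hy)
    · simp [rate_eq_zero]
    · exact hv y hy
    · rw [rate_comm, dist_comm]
      exact hv x hx
    · exact hlip x hx y hy
  · rintro x (rfl | hx)
    · exact hp
    · exact hM.dist_le x hx
  · rintro x (rfl | hx) hxi
    -- The new base point lies outside `domain M`, hence outside `domain X`.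
    · obtain ⟨w, hw⟩ := interior_subset hxi
      exact absurd ⟨w, hM.subset hw⟩ hpM
    · exact hM.mem_of_interior x hx hxi

end HypConvexField

/-! ### The extension theorem. -/

theorem theorem4p1 (C : Set UpperHalfPlane) (hC : IsCompact C)
    (X : Set HypConvexField.TangentH) (hX : HypConvexField.IsConvexField X)
    (hXc : IsCompact X) (hXC : C ⊆ HypConvexField.domain X)
    (k : ℝ) (hk : 0 ≤ k) (hXk : HypConvexField.IsLip k X) :
    ∃ Y : Set HypConvexField.TangentH,
      HypConvexField.IsConvexField Y ∧ IsCompact Y ∧ HypConvexField.IsLip k Y ∧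
      HypConvexField.IsExtension X Y ∧
      HypConvexField.domain Y =
        HypConvexField.domain X ∪ HypConvexField.hypConvexHull C := by
  open HypConvexField in
  have hdom : IsCompact (domain X) := by
    rw [domain_eq_image]
    exact hXc.image continuous_fst
  let o := UpperHalfPlane.I
  obtain ⟨ρ₀, hρ₀⟩ := hdom.isBounded.subset_closedBall o
  set ρ := max ρ₀ 0
  have hρ : 0 ≤ ρ := le_max_right _ _
  have hdρ : domain X ⊆ Metric.closedBall o ρ :=
    hρ₀.trans (Metric.closedBall_subset_closedBall (le_max_left _ _))
  have hXρ : ∀ x ∈ X, dist x.1 o ≤ ρ := fun x hx => hdρ ⟨x.2, hx⟩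
  obtain ⟨c, hc, hlip⟩ := exists_isLip_union_inwardField hXc hk hXk hρ hXρ
  obtain ⟨M, hM⟩ := exists_maximal_isAdmissible
    (⟨subset_rfl, hlip, hXρ, fun x hx _ => hx⟩ : IsAdmissible X (inwardField o ρ c) k o ρ X)
  have hMdom : ∀ p, dist p o ≤ ρ → p ∈ domain M := by
    intro p hp
    by_contra hpM
    obtain ⟨v, hv⟩ := hM.prop.exists_insert hk hc hρ hp hpM
    exact hpM ⟨v, hM.le_of_ge hv (Set.subset_insert _ _) (Set.mem_insert _ _)⟩
  have hMclosed : IsClosed M := by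
    rw [← closure_subset_iff_isClosed]
    exact hM.le_of_ge (hM.prop.closure hX.1) subset_closure
  have hMconv : ∀ p, Convex ℝ (fiber M p) := by
    intro p
    have h : convexHull ℝ (fiber M p) ⊆ fiber M p := fun v hv =>
      hM.le_of_ge (hM.prop.fiberHull hX) (subset_fiberHull M) (show (p, v) ∈ fiberHull M from hv)
    rw [← h.antisymm (subset_convexHull ℝ _)]
    exact convex_convexHull ℝ _
  have hMcompact : IsCompact M := by
    obtain ⟨K, hK⟩ := exists_inner_le hk hc hρ o
    refine ((isCompact_closedBall o ρ).prod (isCompact_closedBall (0 : ℂ) (2 * K))).of_isClosed_subset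
      hMclosed fun x hx => ⟨hM.prop.dist_le x hx, ?_⟩
    rw [mem_closedBall_zero_iff]
    obtain ⟨U, hU, hUK⟩ := exists_finset_norm_le
    refine hUK _ _ fun u hu => ?_
    obtain ⟨w, hw, hwK⟩ := hK x.1 (hM.prop.dist_le x hx) u (hU u hu)
    refine hwK x.2 ?_
    have := isLip_iff.1 hM.prop.isLip x (Or.inl hx) w (Or.inr hw)
    linarith
  have hhull : hypConvexHull C ⊆ Metric.closedBall o ρ :=
    hypConvexHull_subset (hXC.trans hdρ) (geodConvex_closedBall o ρ)
  -- `M` lives over the whole ball; restricting it to the closed set `D` gives the prescribed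
  -- domain.
  set D := domain X ∪ hypConvexHull C with hD
  have hDclosed : IsClosed D := hdom.isClosed.union (isClosed_hypConvexHull hC)
  have hYclosed : IsClosed (M ∩ Prod.fst ⁻¹' D) := hMclosed.inter (hDclosed.preimage continuous_fst)
  refine ⟨M ∩ Prod.fst ⁻¹' D, ⟨hYclosed, fun p => ?_⟩,
    hMcompact.of_isClosed_subset hYclosed Set.inter_subset_left,
    hM.prop.isLip.mono (Set.inter_subset_left.trans Set.subset_union_left), ⟨?_, ?_⟩, ?_⟩
  · intro v hv w hw a b ha hb hab
    exact ⟨hMconv p hv.1 hw.1 ha hb hab, hv.2⟩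
  · exact fun x hx => ⟨hM.prop.subset hx, Or.inl ⟨x.2, hx⟩⟩
  · intro U hU hUX p hp
    ext v
    constructor
    -- An open set over which `X` is defined lies in the interior of `domain X`, where admissible
    -- fields coincide with `X`.
    · exact fun hv => hM.prop.mem_of_interior (p, v) hv.1 (interior_maximal hUX hU hp)
    · exact fun hv => ⟨hM.prop.subset hv, Or.inl ⟨v, hv⟩⟩
  · ext p
    constructor
    · rintro ⟨v, hv⟩
      exact hv.2
    · intro hp
      obtain ⟨v, hv⟩ := hMdom p (hp.elim (fun h => hdρ h) fun h => hhull h)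
      exact ⟨v, hv, hp⟩
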